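/- Let $d,m\ge 0$ be integers and let $P=P_1+\dots+P_m\subseteq\mathbb{R}^{d}\times\mathbb{R}=\mathbb{R}^{d+1}$ be the zonotope generated by line segments $P_i=[a_i,b_i]$, $i=1,\dots,m$ (the Minkowski sum of the $P_i$; the segments may be degenerate, and $P=\{0\}$ if $m=0$). Let $\mathcal{V}(P)$ be the set of vertices of $P$ and $\pi:\mathbb{R}^d\times\mathbb{R}\to\mathbb{R}^d$ the projection that drops the last coordinate. An upper face of $P$ is the set of maximizers over $P$ of a linear functional $\ell$ on $\mathbb{R}^{d+1}$ with $\ell(0,\dots,0,1)>0$. Suppose that (i) the generating line segments are in general position: any at most $d+1$ of the direction vectors $b_i-a_i$ (with distinct indices) are linearly independent; (ii) the projected vertices of $P$ are in general position: whenever $v_0,\dots,v_k\in\mathcal{V}(P)$, $k\le d$, are affinely independent in $\mathbb{R}^{d+1}$, their projections $\pi(v_0),\dots,\pi(v_k)$ are affinely independent in $\mathbb{R}^{d}$. Then the number of vertices of $P$ that lie on upper faces of $P$ is exactly $$\sum_{j=0}^{d}\binom{m}{j}.$$ Without the assumptions (i) and (ii), this number is an upper bound: the number of vertices of $P$ that lie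 on upper faces of $P$ is at most $\sum_{j=0}^{d}\binom{m}{j}$. -/

import Mathlib

open scoped Pointwise

/-- The zonotope generated by the line segments `[a i, b i]`: their Minkowski sum. -/
def zonotope {d m : ℕ} (a b : Fin m → (Fin d → ℝ) × ℝ) : Set ((Fin d → ℝ) × ℝ) :=
  ∑ i, segment ℝ (a i) (b i)

/-- The vertices of a polytope, i.e. its extreme points. -/
def vertices {d : ℕ} (P : Set ((Fin d → ℝ) × ℝ)) : Set ((Fin d → ℝ) × ℝ) :=
  P.extremePoints ℝ

/-- The upper faces of `P`: the sets of maximizers over `P` of the linear functionals with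
positive last coordinate, i.e. the faces with an outer normal vector pointing upwards. -/
def upperFaces {d : ℕ} (P : Set ((Fin d → ℝ) × ℝ)) : Set (Set ((Fin d → ℝ) × ℝ)) :=
  {F | ∃ l : StrongDual ℝ ((Fin d → ℝ) × ℝ), 0 < l (0, 1) ∧ F = l.toExposed P}

/-- The vertices of `P` that lie on its upper faces. -/
def upperVertices {d : ℕ} (P : Set ((Fin d → ℝ) × ℝ)) : Set ((Fin d → ℝ) × ℝ) :=
  {v ∈ vertices P | ∃ F ∈ upperFaces P, v ∈ F}

/-- The segments `[a i, b i]` in `ℝ^(d+1)` are in general position: any at most `d + 1` of their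
direction vectors are linearly independent. -/
def SegmentsInGeneralPosition {d m : ℕ} (a b : Fin m → (Fin d → ℝ) × ℝ) : Prop :=
  ∀ s : Finset (Fin m), s.card ≤ d + 1 → LinearIndependent ℝ (fun i : s => b i - a i)

/-- The projected vertices of `P` are in general position: any at most `d + 1` vertices of `P`
have affinely independent projections to `ℝ^d`, unless the vertices themselves are already
affinely dependent in `ℝ^(d+1)`. The exception is needed because a polytope can have affine
dependencies between few vertices that survive every projection, such as the one between the four
vertices of a parallelogram. -/
def ProjectedVerticesInGeneralPosition {d : ℕ} (P : Set ((Fin d → ℝ) × ℝ)) : Prop :=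
  ∀ s : Finset ((Fin d → ℝ) × ℝ), (s : Set ((Fin d → ℝ) × ℝ)) ⊆ vertices P → s.card ≤ d + 1 →
    AffineIndependent ℝ (fun v : s => (v : (Fin d → ℝ) × ℝ)) →
    AffineIndependent ℝ (fun v : s => (v : (Fin d → ℝ) × ℝ).1)

/-! A vertex of the zonotope chooses an endpoint of each segment, so vertices are encoded by sets
`S` of indices, and both bounds become statements about shattering, since the sum of binomials
counts the sets of size at most `d`. Upper bound: if the family of upper vertices shattered some `T`
with more than `d` elements, a nontrivial combination of the directions in `T` would point weakly
upwards along the vertical, and a suitable upper vertex could be moved along it inside the zonotope.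
Pajor's inequality then bounds the family by the number of sets of size at most `d`. Lower bound:
for each `T` of size at most `d`, general position gives an upward functional vanishing on exactly
the directions in `T`. Small perturbations realise every sign pattern on `T` with fixed signs
elsewhere, and the reverse Pajor inequality applies. -/

open Finset in
theorem sum_range_choose_eq_card_filter_card_le (d m : ℕ) :
    ∑ j ∈ range (d + 1), m.choose j = #{s : Finset (Fin m) | #s ≤ d} := by
  rw [card_eq_sum_card_fiberwise (f := card) (t := range (d + 1))
    (fun s hs => by simpa [Nat.lt_succ_iff] using hs)]
  refine sum_congr rfl fun j hj => ?_
  conv_lhs => rw [← Fintype.card_fin m, ← card_univ, ← card_powersetCard]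
  congr 1
  ext s
  simp only [mem_powersetCard, mem_filter, mem_univ, true_and, subset_univ]
  rw [mem_range] at hj
  omega

open Finset in
/-- The reverse of Pajor's inequality: a family of sets has at least as many members as there are
sets `s` such that it contains all the sets having a certain trace on the complement of `s`. -/
theorem Finset.card_le_card_of_forall_exists_trace {α : Type*} [Fintype α] [DecidableEq α]
    (𝒜 ℬ : Finset (Finset α))
    (h : ∀ s ∈ ℬ, ∃ t, Disjoint s t ∧ ∀ u, u \ s = t → u ∈ 𝒜) : #ℬ ≤ #𝒜 := by
  -- If `𝒜ᶜ` shattered `sᶜ`, some set outside `𝒜` would have trace `t` there. Pajor for `𝒜ᶜ`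
  -- finishes the count.
  have hdisj : Disjoint (ℬ.image compl) (𝒜ᶜ).shatterer := by
    rw [disjoint_left]
    intro r hr hr'
    obtain ⟨s, hs, rfl⟩ := mem_image.1 hr
    obtain ⟨t, hst, ht⟩ := h s hs
    obtain ⟨u, hu, hut⟩ := mem_shatterer.1 hr' (subset_compl_iff_disjoint_left.2 hst)
    refine (mem_compl.1 hu) (ht u ?_)
    rw [← hut, sdiff_eq, inf_comm]
    rfl
  have h1 := card_le_univ (ℬ.image compl ∪ (𝒜ᶜ).shatterer)
  rw [card_union_of_disjoint hdisj, card_image_of_injective _ compl_injective] at h1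
  have h2 := (𝒜ᶜ).card_le_card_shatterer
  have h3 := card_add_card_compl 𝒜
  omega

/-! ### Perturbation and linear algebra -/

/-- If `x` and `y` are families of reals, then adding a small multiple of `y` to `x` does not
change the signs of the nonzero entries of `x`. -/
theorem exists_pos_forall_add_mul_sign {ι : Type*} [Finite ι] (x y : ι → ℝ) :
    ∃ ε > 0, ∀ i, (0 < x i → 0 < x i + ε * y i) ∧ (x i < 0 → x i + ε * y i < 0) := by
  have key : ∀ᶠ ε : ℝ in nhds 0,
      ∀ i, (0 < x i → 0 < x i + ε * y i) ∧ (x i < 0 → x i + ε * y i < 0) := by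
    rw [Filter.eventually_all]
    intro i
    have hc : Filter.Tendsto (fun ε : ℝ => x i + ε * y i) (nhds 0) (nhds (x i)) := by
      have : Continuous fun ε : ℝ => x i + ε * y i := by fun_prop
      simpa using this.tendsto 0
    rw [Filter.eventually_and, Filter.eventually_imp_distrib_left,
      Filter.eventually_imp_distrib_left]
    exact ⟨fun h => hc.eventually_const_lt h, fun h => hc.eventually_lt_const h⟩
  obtain ⟨ε, h, hε⟩ := ((key.filter_mono nhdsWithin_le_nhds).and
    (self_mem_nhdsWithin : Set.Ioi (0 : ℝ) ∈ nhdsWithin 0 (Set.Ioi 0))).exists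
  exact ⟨ε, hε, h⟩

theorem LinearIndependent.exists_dual_apply_eq {K V ι : Type*} [Field K] [AddCommGroup V]
    [Module K V] {v : ι → V} (hv : LinearIndependent K v) (σ : ι → K) :
    ∃ f : Module.Dual K V, ∀ i, f (v i) = σ i := by
  obtain ⟨f, hf⟩ := ((Finsupp.linearCombination K σ).comp hv.repr).exists_extend
  refine ⟨f, fun i => ?_⟩
  have := LinearMap.congr_fun hf ⟨v i, Submodule.subset_span ⟨i, rfl⟩⟩
  simpa [hv.repr_eq_single i] using this

theorem Submodule.exists_dual_eq_zero_and_forall_apply_ne_zero {K V ι : Type*} [Field K]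
    [Infinite K] [AddCommGroup V] [Module K V] [Finite ι] (p : Submodule K V) (v : ι → V)
    (hv : ∀ i, v i ∉ p) :
    ∃ f : Module.Dual K V, (∀ x ∈ p, f x = 0) ∧ ∀ i, f (v i) ≠ 0 := by
  obtain ⟨f, hf⟩ := Module.exists_dual_forall_apply_ne_zero (K := K) (fun i => p.mkQ (v i))
    (fun i => by simpa using hv i)
  refine ⟨f.comp p.mkQ, fun x hx => ?_, hf⟩
  rw [LinearMap.comp_apply, p.mkQ_apply, (Submodule.Quotient.mk_eq_zero p).2 hx, map_zero]

theorem affineIndependent_option {K V ι : Type*} [DivisionRing K] [AddCommGroup V] [Module K V]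
    (p : V) (f : ι → V) :
    AffineIndependent K (fun o : Option ι => p + o.elim 0 f) ↔ LinearIndependent K f := by
  rw [affineIndependent_iff_linearIndependent_vsub K _ (none : Option ι)]
  let e : ι ≃ {x : Option ι // x ≠ none} := Equiv.ofBijective (fun i => ⟨some i, by simp⟩)
    ⟨fun i j h => by simpa using h, fun ⟨x, hx⟩ => by
      obtain ⟨i, rfl⟩ := Option.ne_none_iff_exists'.1 hx
      exact ⟨i, rfl⟩⟩
  exact (linearIndependent_equiv' e (by ext i; simp; rfl)).symm

/-! ### Vertices of zonotopes -/

variable {d m : ℕ} {a b : Fin m → (Fin d → ℝ) × ℝ}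

theorem mem_zonotope_iff {x : (Fin d → ℝ) × ℝ} :
    x ∈ zonotope a b ↔
      ∃ t : Fin m → ℝ, (∀ i, t i ∈ Set.Icc (0 : ℝ) 1) ∧ ∑ i, (a i + t i • (b i - a i)) = x := by
  simp only [zonotope, Set.mem_fintype_sum, segment_eq_image', Set.mem_image]
  constructor
  · rintro ⟨g, hg, rfl⟩
    choose t ht htg using hg
    exact ⟨t, ht, by simp only [htg]⟩
  · rintro ⟨t, ht, rfl⟩
    exact ⟨_, fun i => ⟨t i, ht i, rfl⟩, rfl⟩

/-- The point of the zonotope obtained by choosing the endpoint `b i` for `i ∈ S` and the endpoint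
`a i` for `i ∉ S`. -/
def zonotopePoint (a b : Fin m → (Fin d → ℝ) × ℝ) (S : Finset (Fin m)) : (Fin d → ℝ) × ℝ :=
  ∑ i, (a i + (if i ∈ S then (1 : ℝ) else 0) • (b i - a i))

theorem zonotopePoint_mem (S : Finset (Fin m)) : zonotopePoint a b S ∈ zonotope a b :=
  mem_zonotope_iff.2 ⟨_, fun i => by split_ifs <;> simp, rfl⟩

theorem zonotopePoint_insert {S : Finset (Fin m)} {i : Fin m} (hi : i ∉ S) :
    zonotopePoint a b (insert i S) = zonotopePoint a b S + (b i - a i) := by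
  have : ∀ j, a j + (if j ∈ insert i S then (1 : ℝ) else 0) • (b j - a j) =
      (a j + (if j ∈ S then (1 : ℝ) else 0) • (b j - a j)) + if j = i then b i - a i else 0 := by
    intro j
    by_cases hj : j = i
    · subst hj; simp [hi]
    · simp [hj]
  rw [zonotopePoint, Finset.sum_congr rfl fun j _ => this j, Finset.sum_add_distrib]
  simp [zonotopePoint]

/-- `l` is positive on the directions of the segments indexed by `S`, and negative on the others. -/
def SeparatesDirections (a b : Fin m → (Fin d → ℝ) × ℝ) (l : StrongDual ℝ ((Fin d → ℝ) × ℝ))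
    (S : Finset (Fin m)) : Prop :=
  ∀ i, (i ∈ S → 0 < l (b i - a i)) ∧ (i ∉ S → l (b i - a i) < 0)

namespace SeparatesDirections

variable {l : StrongDual ℝ ((Fin d → ℝ) × ℝ)} {S : Finset (Fin m)}

theorem isMax (h : SeparatesDirections a b l S) (x : (Fin d → ℝ) × ℝ) (hx : x ∈ zonotope a b) :
    l x ≤ l (zonotopePoint a b S) ∧ (l (zonotopePoint a b S) ≤ l x → x = zonotopePoint a b S) := by
  obtain ⟨t, ht, rfl⟩ := mem_zonotope_iff.1 hx
  have hle : ∀ i ∈ Finset.univ, l (a i + t i • (b i - a i)) ≤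
      l (a i + (if i ∈ S then (1 : ℝ) else 0) • (b i - a i)) := by
    intro i _
    simp only [map_add, map_smul, smul_eq_mul, add_le_add_iff_left]
    split_ifs with hi
    · exact mul_le_mul_of_nonneg_right (ht i).2 ((h i).1 hi).le
    · exact mul_le_mul_of_nonpos_right (ht i).1 ((h i).2 hi).le
  simp only [zonotopePoint, map_sum]
  refine ⟨Finset.sum_le_sum hle, fun hge => ?_⟩
  have heq := (Finset.sum_eq_sum_iff_of_le hle).1 (le_antisymm (Finset.sum_le_sum hle) hge)
  refine Finset.sum_congr rfl fun i hi => ?_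
  have hli : l (b i - a i) ≠ 0 := by
    by_cases hiS : i ∈ S
    exacts [((h i).1 hiS).ne', ((h i).2 hiS).ne]
  have := heq i hi
  simp only [map_add, map_smul, smul_eq_mul, add_right_inj] at this
  rw [mul_right_cancel₀ hli this]

theorem zonotopePoint_mem_vertices (h : SeparatesDirections a b l S) :
    zonotopePoint a b S ∈ vertices (zonotope a b) :=
  exposedPoints_subset_extremePoints ⟨zonotopePoint_mem S, l, h.isMax⟩

theorem zonotopePoint_mem_upperVertices (h : SeparatesDirections a b l S) (hl : 0 < l (0, 1)) :
    zonotopePoint a b S ∈ upperVertices (zonotope a b) :=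
  ⟨h.zonotopePoint_mem_vertices, _, ⟨l, hl, rfl⟩, zonotopePoint_mem S, fun x hx => (h.isMax x hx).1⟩

theorem eq_of_zonotopePoint_eq {S' : Finset (Fin m)} (h : SeparatesDirections a b l S)
    (heq : zonotopePoint a b S' = zonotopePoint a b S) : S' = S := by
  have hle : ∀ i ∈ Finset.univ, l (a i + (if i ∈ S' then (1 : ℝ) else 0) • (b i - a i)) ≤
      l (a i + (if i ∈ S then (1 : ℝ) else 0) • (b i - a i)) := by
    intro i _
    have := h i
    by_cases hi : i ∈ S <;> by_cases hi' : i ∈ S' <;> simp_all [le_of_lt]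
  have hs := congrArg l heq
  simp only [zonotopePoint, map_sum] at hs
  ext i
  have := (Finset.sum_eq_sum_iff_of_le hle).1 hs i (Finset.mem_univ i)
  have hi := h i
  by_cases hi : i ∈ S <;> by_cases hi' : i ∈ S' <;> simp_all

end SeparatesDirections

theorem eq_zero_of_mem_extremePoints {v w : (Fin d → ℝ) × ℝ} {P : Set ((Fin d → ℝ) × ℝ)}
    (hv : v ∈ P.extremePoints ℝ) (h₁ : v + w ∈ P) (h₂ : v - w ∈ P) : w = 0 := by
  have := (mem_extremePoints.1 hv).2 _ h₁ _ h₂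
    ⟨1 / 2, 1 / 2, by norm_num, by norm_num, by norm_num, by module⟩
  simpa using this.1

/-- A coefficient strictly inside the unit interval can move both ways, which makes `v` a midpoint.
-/
theorem eq_zero_of_mem_vertices {v : (Fin d → ℝ) × ℝ} (hv : v ∈ vertices (zonotope a b))
    {t : Fin m → ℝ} (ht : ∀ i, t i ∈ Set.Icc (0 : ℝ) 1)
    (htv : ∑ i, (a i + t i • (b i - a i)) = v) {j : Fin m} (hj : t j ∈ Set.Ioo (0 : ℝ) 1) :
    b j - a j = 0 := by
  obtain ⟨δ, hδ, hδ0, hδ1⟩ : ∃ δ > 0, δ ≤ t j ∧ δ ≤ 1 - t j :=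
    ⟨min (t j) (1 - t j), lt_min hj.1 (by linarith [hj.2]), min_le_left _ _, min_le_right _ _⟩
  have key : ∀ s : ℝ, |s| ≤ δ → v + s • (b j - a j) ∈ zonotope a b := by
    intro s hs
    rw [abs_le] at hs
    refine mem_zonotope_iff.2 ⟨fun i => t i + if i = j then s else 0, fun i => ?_, ?_⟩
    · by_cases hij : i = j
      · subst hij
        simp only [if_true]
        constructor <;> linarith
      · simpa [hij] using ht i
    · simp only [add_smul, ite_smul, zero_smul, ← htv, ← add_assoc]
      rw [Finset.sum_add_distrib]
      simp
  have h0 := eq_zero_of_mem_extremePoints hv (key δ (abs_of_pos hδ).le)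
    (by
      rw [sub_eq_add_neg, ← neg_smul]
      exact key (-δ) (by rw [abs_neg, abs_of_pos hδ]))
  exact (smul_eq_zero.1 h0).resolve_left hδ.ne'

/-- Leaving degenerate segments out of `S` ensures that shattered sets contain only nonzero
directions. -/
theorem exists_zonotopePoint_eq {v : (Fin d → ℝ) × ℝ} (hv : v ∈ vertices (zonotope a b)) :
    ∃ S : Finset (Fin m), zonotopePoint a b S = v ∧ ∀ i ∈ S, b i - a i ≠ 0 := by
  classical
  obtain ⟨t, ht, htv⟩ := mem_zonotope_iff.1 (extremePoints_subset hv)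
  refine ⟨Finset.univ.filter fun i => t i = 1 ∧ b i - a i ≠ 0, ?_, fun i hi => ?_⟩
  · rw [← htv, zonotopePoint]
    refine Finset.sum_congr rfl fun i _ => ?_
    congr 1
    by_cases hi : b i - a i = 0
    · simp [hi]
    · congr 1
      by_cases h1 : t i = 1
      · simp [h1, hi]
      · have h0 : t i = 0 := by
          by_contra h0
          exact hi (eq_zero_of_mem_vertices hv ht htv
            ⟨lt_of_le_of_ne (ht i).1 (Ne.symm h0), lt_of_le_of_ne (ht i).2 h1⟩)
        simp [h0]
  · exact (Finset.mem_filter.1 hi).2.2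

/-! ### The upper bound -/

/-- Any `d + 1` vectors in `ℝ^(d+1)` have a nontrivial linear combination pointing vertically
upwards. -/
theorem exists_sum_smul_eq_vertical (c : Fin m → (Fin d → ℝ) × ℝ) {T : Finset (Fin m)}
    (hT : d < T.card) :
    ∃ g : Fin m → ℝ, ∃ s : ℝ, 0 ≤ s ∧ ∑ i ∈ T, g i • c i = (0, s) ∧ ∃ i ∈ T, g i ≠ 0 := by
  have hdep : ¬ LinearIndepOn ℝ (fun i => (c i).1) (T : Set (Fin m)) := by
    intro h
    have := LinearIndependent.fintype_card_le_finrank h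
    simp at this
    omega
  obtain ⟨g, hg, i, hi, hgi⟩ := not_linearIndepOn_finset_iff.1 hdep
  have hsum : ∑ i ∈ T, g i • c i = (0, ∑ i ∈ T, g i * (c i).2) := by
    ext1
    · simpa [Prod.fst_sum] using hg
    · simp [Prod.snd_sum]
  rcases le_total 0 (∑ i ∈ T, g i * (c i).2) with h | h
  · exact ⟨g, _, h, hsum, i, hi, hgi⟩
  · refine ⟨fun i => -g i, -∑ i ∈ T, g i * (c i).2, neg_nonneg.2 h, ?_, i, hi, neg_ne_zero.2 hgi⟩
    simp [Finset.sum_neg_distrib, hsum]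

theorem not_shatters_of_forall_mem_upperVertices {𝒜 : Finset (Finset (Fin m))}
    (h𝒜 : ∀ S ∈ 𝒜, zonotopePoint a b S ∈ upperVertices (zonotope a b) ∧ ∀ i ∈ S, b i - a i ≠ 0)
    {T : Finset (Fin m)} (hT : d < T.card) : ¬ 𝒜.Shatters T := by
  intro hsh
  obtain ⟨g, s, hs, hsum, j, hjT, hgj⟩ := exists_sum_smul_eq_vertical (fun i => b i - a i) hT
  have hne : b j - a j ≠ 0 := by
    obtain ⟨S, hS, hTS⟩ := hsh (Finset.Subset.refl T)
    exact (h𝒜 S hS).2 j (Finset.inter_eq_left.1 hTS hjT)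
  -- With this trace, coefficients that must decrease start at 1 and those that must increase start
  -- at 0.
  obtain ⟨S, hS, hTS⟩ := hsh (Finset.filter_subset (fun i => g i < 0) T)
  have hmem : ∀ i ∈ T, (i ∈ S ↔ g i < 0) := fun i hi => by
    have := Finset.ext_iff.1 hTS i
    simpa [hi] using this
  obtain ⟨hv, _, ⟨l, hl, rfl⟩, -, hmax⟩ := (h𝒜 S hS).1
  obtain ⟨ε, hε, hεg⟩ : ∃ ε : ℝ, 0 < ε ∧ ∀ i, ε * |g i| < 1 := by
    obtain ⟨ε, hε, h⟩ := exists_pos_forall_add_mul_sign (fun _ => (1 : ℝ)) (fun i => -|g i|)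
    exact ⟨ε, hε, fun i => by have := (h i).1 one_pos; linarith⟩
  let t : Fin m → ℝ := fun i => (if i ∈ S then 1 else 0) + if i ∈ T then ε * g i else 0
  have ht : ∀ i, t i ∈ Set.Icc (0 : ℝ) 1 ∧ (i ∈ T → g i ≠ 0 → t i ∈ Set.Ioo (0 : ℝ) 1) := by
    intro i
    simp only [t]
    by_cases hiT : i ∈ T
    · have hi := hεg i
      by_cases hiS : i ∈ S
      · have hg := (hmem i hiT).1 hiS
        rw [abs_of_neg hg] at hi
        have := mul_neg_of_pos_of_neg hε hg
        simp only [hiS, hiT, if_true]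
        exact ⟨⟨by linarith, by linarith⟩, fun _ _ => ⟨by linarith, by linarith⟩⟩
      · have hg := not_lt.1 (fun h => hiS ((hmem i hiT).2 h))
        rw [abs_of_nonneg hg] at hi
        have := mul_nonneg hε.le hg
        simp only [hiS, hiT, if_true, if_false]
        refine ⟨⟨by linarith, by linarith⟩, fun _ h0 => ⟨?_, by linarith⟩⟩
        have := mul_pos hε (lt_of_le_of_ne hg (Ne.symm h0))
        linarith
    · simp only [hiT, if_false, add_zero, false_imp_iff, and_true]
      split_ifs <;> simp
  have hpt : ∑ i, (a i + t i • (b i - a i)) =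
      zonotopePoint a b S + ε • ((0, s) : (Fin d → ℝ) × ℝ) := by
    rw [← hsum, Finset.smul_sum]
    simp only [t, add_smul, ite_smul, zero_smul, ← add_assoc, zonotopePoint]
    rw [Finset.sum_add_distrib]
    simp [mul_smul]
  have hle := hmax _ (mem_zonotope_iff.2 ⟨t, fun i => (ht i).1, hpt⟩)
  have h0s : ((0, s) : (Fin d → ℝ) × ℝ) = s • (0, 1) := by simp
  -- Maximality of `l` forbids a rise, so the move is trivial and the vertex itself has a fractional
  -- coefficient at `j`.
  have hs0 : s = 0 := by
    rw [h0s, map_add, map_smul, map_smul, smul_eq_mul, smul_eq_mul] at hle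
    by_contra h
    have := mul_pos hε (mul_pos (lt_of_le_of_ne hs (Ne.symm h)) hl)
    linarith
  rw [hs0] at hpt
  exact hne (eq_zero_of_mem_vertices hv (fun i => (ht i).1) (hpt.trans (by simp))
    ((ht j).2 hjT hgj))

theorem encard_upperVertices_le (a b : Fin m → (Fin d → ℝ) × ℝ) :
    (upperVertices (zonotope a b)).encard ≤
      ((∑ j ∈ Finset.range (d + 1), m.choose j : ℕ) : ℕ∞) := by
  classical
  let 𝒜 : Finset (Finset (Fin m)) := {S | zonotopePoint a b S ∈ upperVertices (zonotope a b) ∧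
    ∀ i ∈ S, b i - a i ≠ 0}
  have hsub : upperVertices (zonotope a b) ⊆ zonotopePoint a b '' 𝒜 := by
    intro v hv
    obtain ⟨S, rfl, hS⟩ := exists_zonotopePoint_eq hv.1
    exact ⟨S, by simpa [𝒜] using ⟨hv, by simpa using hS⟩, rfl⟩
  refine ((Set.encard_le_encard hsub).trans (Set.encard_image_le _ _)).trans ?_
  rw [Set.encard_coe_eq_coe_finsetCard, sum_range_choose_eq_card_filter_card_le, Nat.cast_le]
  refine 𝒜.card_le_card_shatterer.trans (Finset.card_le_card fun T hT => ?_)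
  simp only [Finset.mem_filter, Finset.mem_univ, true_and]
  by_contra! h
  exact not_shatters_of_forall_mem_upperVertices (fun S hS => (Finset.mem_filter.1 hS).2) h
    (Finset.mem_shatterer.1 hT)

/-! ### The lower bound -/

/-- A functional vanishing on some linearly independent directions, and on no others, can be
perturbed so as to take prescribed signs on the former. -/
theorem exists_separatesDirections {T U : Finset (Fin m)}
    (hT : LinearIndependent ℝ (fun i : T => b i - a i)) {l : Module.Dual ℝ ((Fin d → ℝ) × ℝ)}
    (hlT : ∀ i ∈ T, l (b i - a i) = 0) (hl : ∀ i ∉ T, l (b i - a i) ≠ 0)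
    (hU : ∀ i ∉ T, (i ∈ U ↔ 0 < l (b i - a i))) :
    ∃ l' : StrongDual ℝ ((Fin d → ℝ) × ℝ),
      SeparatesDirections a b l' U ∧ (0 < l (0, 1) → 0 < l' (0, 1)) := by
  obtain ⟨g, hg⟩ := hT.exists_dual_apply_eq fun i => if (i : Fin m) ∈ U then (1 : ℝ) else -1
  -- The index `none` carries the vertical vector, so one `ε` also preserves upwardness.
  obtain ⟨ε, hε, h⟩ := exists_pos_forall_add_mul_sign
    (fun o : Option (Fin m) => l (o.elim (0, 1) fun i => b i - a i))
    (fun o : Option (Fin m) => g (o.elim (0, 1) fun i => b i - a i))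
  refine ⟨(l + ε • g).toContinuousLinearMap, fun i => ?_, fun h0 => by simpa using (h none).1 h0⟩
  change (i ∈ U → 0 < l (b i - a i) + ε * g (b i - a i)) ∧
    (i ∉ U → l (b i - a i) + ε * g (b i - a i) < 0)
  by_cases hi : i ∈ T
  · rw [hlT i hi, hg ⟨i, hi⟩]
    by_cases hiU : i ∈ U <;> simp [hiU, hε]
  · refine ⟨fun hiU => (h (some i)).1 ((hU i hi).1 hiU), fun hiU => (h (some i)).2 ?_⟩
    exact lt_of_le_of_ne (not_lt.1 fun h' => hiU ((hU i hi).2 h')) (hl i hi)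

theorem SegmentsInGeneralPosition.notMem_span (h : SegmentsInGeneralPosition a b)
    {T : Finset (Fin m)} (hT : T.card ≤ d) {j : Fin m} (hj : j ∉ T) :
    b j - a j ∉ Submodule.span ℝ ((fun i => b i - a i) '' T) := by
  have hli : LinearIndepOn ℝ (fun i => b i - a i) (insert j T : Set (Fin m)) := by
    rw [← Finset.coe_insert]
    exact h (insert j T) ((Finset.card_insert_le _ _).trans (by omega))
  exact ((linearIndepOn_insert (by simpa using hj)).1 hli).2

/-- Perturbing a functional that vanishes exactly on `T` exhibits a vertex whose translates by each
direction in `T` are also vertices. These at most `d + 1` points are affinely independent, hence so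
are their projections. -/
theorem ProjectedVerticesInGeneralPosition.linearIndependent_fst
    (h₁ : SegmentsInGeneralPosition a b)
    (h₂ : ProjectedVerticesInGeneralPosition (zonotope a b)) {T : Finset (Fin m)}
    (hT : T.card ≤ d) : LinearIndependent ℝ (fun i : T => (b i - a i).1) := by
  classical
  have hli := h₁ T (hT.trans d.le_succ)
  obtain ⟨l, hlT, hl⟩ := Submodule.exists_dual_eq_zero_and_forall_apply_ne_zero
    (Submodule.span ℝ ((fun i => b i - a i) '' T)) (fun j : {j // j ∉ T} => b j - a j)
    (fun j => h₁.notMem_span hT j.2)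
  have hlT' : ∀ i ∈ T, l (b i - a i) = 0 :=
    fun i hi => hlT _ (Submodule.subset_span ⟨i, hi, rfl⟩)
  have hl' : ∀ i ∉ T, l (b i - a i) ≠ 0 := fun i hi => hl ⟨i, hi⟩
  let U : Finset (Fin m) := {i | i ∉ T ∧ 0 < l (b i - a i)}
  let p : Option T → (Fin d → ℝ) × ℝ := fun o =>
    zonotopePoint a b U + o.elim 0 fun i : T => b i - a i
  have hp : AffineIndependent ℝ p := (affineIndependent_option _ _).2 hli
  have hpv : ∀ o, p o ∈ vertices (zonotope a b) := by
    intro o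
    cases o with
    | none =>
      obtain ⟨l', h, -⟩ := exists_separatesDirections (U := U) hli hlT' hl'
        (fun i hi => by simp [U, hi])
      simpa [p] using h.zonotopePoint_mem_vertices
    | some i =>
      obtain ⟨l', h, -⟩ := exists_separatesDirections (U := insert (i : Fin m) U) hli hlT' hl'
        (fun j hj => by
          have : j ≠ i := fun h => hj (h ▸ i.2)
          simp [U, hj, this])
      have := h.zonotopePoint_mem_vertices
      rwa [zonotopePoint_insert (by simp [U])] at this
  have himg : AffineIndependent ℝ
      (fun v : Finset.univ.image p => (v : (Fin d → ℝ) × ℝ)) := by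
    have hr := hp.range
    rwa [← Set.image_univ, ← Finset.coe_univ, ← Finset.coe_image] at hr
  have hproj := h₂ (Finset.univ.image p)
    (fun v hv => by
      obtain ⟨o, -, rfl⟩ := Finset.mem_image.1 (Finset.mem_coe.1 hv)
      exact hpv o)
    (Finset.card_image_le.trans (by simpa using hT)) himg
  have hproj' := hproj.comp_embedding
    ⟨fun o : Option T => ⟨p o, Finset.mem_image_of_mem p (Finset.mem_univ o)⟩,
      fun o o' h => hp.injective (by simpa using h)⟩
  refine (affineIndependent_option (zonotopePoint a b U).1 _).1 ?_
  have hfst : (fun o : Option T => (zonotopePoint a b U).1 +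
      o.elim 0 fun i : T => (b i - a i).1) = fun o => (p o).1 := by
    ext1 o
    cases o <;> simp [p]
  rw [hfst]
  exact hproj'

theorem ProjectedVerticesInGeneralPosition.vertical_notMem_span
    (h₁ : SegmentsInGeneralPosition a b)
    (h₂ : ProjectedVerticesInGeneralPosition (zonotope a b)) {T : Finset (Fin m)}
    (hT : T.card ≤ d) :
    ((0, 1) : (Fin d → ℝ) × ℝ) ∉ Submodule.span ℝ ((fun i => b i - a i) '' T) := by
  intro hmem
  have hli := h₂.linearIndependent_fst h₁ hT
  rw [Set.image_eq_range] at hmem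
  obtain ⟨g, hg⟩ := (Submodule.mem_span_range_iff_exists_fun ℝ).1 hmem
  have hg0 := Fintype.linearIndependent_iff.1 hli g (by
    have := congrArg Prod.fst hg
    rw [Prod.fst_sum] at this
    exact this)
  have : (∑ i : T, g i • (b i - a i)) = 0 := Finset.sum_eq_zero fun i _ => by rw [hg0 i, zero_smul]
  have h01 := congrArg Prod.snd (this.symm.trans hg)
  simp at h01

theorem le_encard_upperVertices (h₁ : SegmentsInGeneralPosition a b)
    (h₂ : ProjectedVerticesInGeneralPosition (zonotope a b)) :
    ((∑ j ∈ Finset.range (d + 1), m.choose j : ℕ) : ℕ∞) ≤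
      (upperVertices (zonotope a b)).encard := by
  classical
  let 𝒜 : Finset (Finset (Fin m)) := {S | ∃ l, 0 < l (0, 1) ∧ SeparatesDirections a b l S}
  have hinj : Set.InjOn (zonotopePoint a b) 𝒜 := by
    intro S' _ S hS heq
    obtain ⟨l, -, hl⟩ := (Finset.mem_filter.1 (Finset.mem_coe.1 hS)).2
    exact hl.eq_of_zonotopePoint_eq heq
  have hsub : zonotopePoint a b '' 𝒜 ⊆ upperVertices (zonotope a b) := by
    rintro _ ⟨S, hS, rfl⟩
    obtain ⟨l, hl0, hl⟩ := (Finset.mem_filter.1 (Finset.mem_coe.1 hS)).2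
    exact hl.zonotopePoint_mem_upperVertices hl0
  refine le_trans ?_ (Set.encard_le_encard hsub)
  rw [hinj.encard_image, Set.encard_coe_eq_coe_finsetCard, Nat.cast_le,
    sum_range_choose_eq_card_filter_card_le]
  refine Finset.card_le_card_of_forall_exists_trace _ _ fun T hT => ?_
  have hT : T.card ≤ d := (Finset.mem_filter.1 hT).2
  obtain ⟨l, hlT, hl, hl0⟩ : ∃ l : Module.Dual ℝ ((Fin d → ℝ) × ℝ),
      (∀ i ∈ T, l (b i - a i) = 0) ∧ (∀ i ∉ T, l (b i - a i) ≠ 0) ∧ 0 < l (0, 1) := by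
    obtain ⟨l, hlT, hl⟩ := Submodule.exists_dual_eq_zero_and_forall_apply_ne_zero
      (Submodule.span ℝ ((fun i => b i - a i) '' T))
      (fun o : Option {j // j ∉ T} => o.elim (0, 1) fun j => b j - a j)
      (fun o => by
        cases o with
        | none => exact h₂.vertical_notMem_span h₁ hT
        | some j => exact h₁.notMem_span hT j.2)
    have hlT' : ∀ i ∈ T, l (b i - a i) = 0 :=
      fun i hi => hlT _ (Submodule.subset_span ⟨i, hi, rfl⟩)
    have hl' : ∀ i ∉ T, l (b i - a i) ≠ 0 := fun i hi => hl (some ⟨i, hi⟩)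
    -- Only nonvanishing on the vertical is known; negating `l` if necessary makes it upward.
    rcases lt_or_gt_of_ne (hl none) with h | h
    · refine ⟨-l, fun i hi => ?_, fun i hi => ?_, neg_pos.2 h⟩
      · rw [LinearMap.neg_apply, hlT' i hi, neg_zero]
      · rw [LinearMap.neg_apply]
        exact neg_ne_zero.2 (hl' i hi)
    · exact ⟨l, hlT', hl', h⟩
  refine ⟨({i | i ∉ T ∧ 0 < l (b i - a i)} : Finset (Fin m)), ?_, fun U hU => ?_⟩
  · rw [Finset.disjoint_left]
    intro i hi hi'
    exact (Finset.mem_filter.1 hi').2.1 hi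
  · obtain ⟨l', h, h0⟩ := exists_separatesDirections (U := U) (h₁ T (hT.trans d.le_succ)) hlT hl
      (fun i hi => by simpa [hi] using Finset.ext_iff.1 hU i)
    exact Finset.mem_filter.2 ⟨Finset.mem_univ _, l', h0 hl0, h⟩

theorem mainTheorem5 (d m : ℕ) (a b : Fin m → (Fin d → ℝ) × ℝ) :
    (SegmentsInGeneralPosition a b → ProjectedVerticesInGeneralPosition (zonotope a b) →
      (upperVertices (zonotope a b)).encard = ((∑ j ∈ Finset.range (d + 1), m.choose j : ℕ) : ℕ∞)) ∧
    (upperVertices (zonotope a b)).encard ≤ ((∑ j ∈ Finset.range (d + 1), m.choose j : ℕ) : ℕ∞) :=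
  ⟨fun h₁ h₂ => le_antisymm (encard_upperVertices_le a b) (le_encard_upperVertices h₁ h₂),
    encard_upperVertices_le a b⟩
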